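/- Let $X$ be a real Banach space, $1<p<\infty$, $q=p/(p-1)$, and let $\Phi:X\to[0,\infty]$ be proper, convex and lower semicontinuous, with compact sublevel sets $\{\Phi\le c\}$ ($c<\infty$), strictly convex on $\mathrm{Dom}(\Phi)=\{u\in X:\Phi(u)<\infty\}$ and positively homogeneous of degree $p$, i.e. $\Phi(tu)=t^p\Phi(u)$ for all $t\ge 0$, $u\in X$ (with $0\cdot\infty=0$). Put $$\lambda_p=\inf\Big\{\frac{p\,\Phi(u)}{\|u\|^p}:u\in X\setminus\{0\}\Big\},\qquad \mu_p=\lambda_p^{1/(p-1)},$$ and assume that $\lambda_p$ is simple: any $u,v\in X\setminus\{0\}$ with $\frac{p\Phi(u)}{\|u\|^p}=\frac{p\Phi(v)}{\|v\|^p}=\lambda_p$ are linearly dependent. A $p$-curve of maximal slope for $\Phi$ is a path $v:[0,\infty)\to X$ which is locally absolutely continuous (for every $T>0$ there is $h\in L^1([0,T])$ with $\|v(t)-v(s)\|\le\int_s^t h(\tau)\,d\tau$ for $0\le s\le t\le T$), along which $t\mapsto\Phi(v(t))$ is nonincreasing, and such that for almost every $t>0$ $$\frac{d}{dt}\Phi(v(t))\le-\frac1p|\dot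 v|^p(t)-\frac1q|\partial\Phi|^q(v(t)),$$ where $|\dot v|(t)=\lim_{h\to0}\|v(t+h)-v(t)\|/|h|$ is the metric derivative and $|\partial\Phi|(u)=\limsup_{z\to0}(\Phi(u)-\Phi(u+z))^+/\|z\|$ is the local slope at $u\in\mathrm{Dom}(\Phi)$ ($|\partial\Phi|(u)=\infty$ for $u\notin\mathrm{Dom}(\Phi)$). Let $v$ be a $p$-curve of maximal slope for $\Phi$ with $v(0)\in\mathrm{Dom}(\Phi)$. Then the limit $w:=\lim_{t\to\infty}e^{\mu_pt}v(t)$ exists in $X$, $w\in\mathrm{Dom}(\Phi)$, and $$\Phi(w)=\lim_{t\to\infty}\Phi\big(e^{\mu_pt}v(t)\big).$$ If $w\ne0$, then $w$ is a minimizer of $\Phi(u)/\|u\|^p$ over $u\in X\setminus\{0\}$, and $$\lambda_p=\lim_{t\to\infty}\frac{p\,\Phi(v(t))}{\|v(t)\|^p}.$$ -/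

import Mathlib

open Filter Topology MeasureTheory Set
open scoped ENNReal NNReal

noncomputable section

namespace RayleighFlow

variable {X : Type*} [NormedAddCommGroup X] [NormedSpace ℝ X]

/-- The effective domain of an extended-valued functional `Φ : X → [0, ∞]`. -/
def Dom (Φ : X → ℝ≥0∞) : Set X := {u | Φ u < ⊤}

/-- The standing assumptions on `Φ : X → [0, ∞]`: proper, convex, lower semicontinuous, with compact
sublevel sets, strictly convex on its domain and positively homogeneous of degree `p`. -/
structure IsAdmissible (p : ℝ) (Φ : X → ℝ≥0∞) : Prop where
  proper : (Dom Φ).Nonempty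
  convex : ConvexOn ℝ≥0 univ Φ
  lsc : LowerSemicontinuous Φ
  compact_sublevel : ∀ c : ℝ≥0, IsCompact {u | Φ u ≤ c}
  strictConvex : StrictConvexOn ℝ≥0 (Dom Φ) Φ
  homogeneous : ∀ (t : ℝ≥0) (u : X), Φ (t • u) = (t : ℝ≥0∞) ^ p * Φ u

/-- The Rayleigh quotient `p Φ(u) / ‖u‖ ^ p`, with values in `[0, ∞]` (only used for `u ≠ 0`). -/
def rayleigh (p : ℝ) (Φ : X → ℝ≥0∞) (u : X) : ℝ≥0∞ :=
  ENNReal.ofReal p * Φ u / ‖u‖ₑ ^ p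

/-- The least Rayleigh quotient `λ_p`, the infimum of `p Φ(u) / ‖u‖ ^ p` over `u ≠ 0`. -/
def leastRayleigh (p : ℝ) (Φ : X → ℝ≥0∞) : ℝ≥0∞ :=
  ⨅ (u : X) (_ : u ≠ 0), rayleigh p Φ u

/-- The rate `μ_p = λ_p ^ (1 / (p - 1))`, as a real number.  Here `λ_p` is finite as soon as
`Φ` is finite at some nonzero vector. -/
def rate (p : ℝ) (Φ : X → ℝ≥0∞) : ℝ :=
  (leastRayleigh p Φ).toReal ^ (1 / (p - 1))

/-- `λ_p` is simple: any two nonzero vectors whose Rayleigh quotient is `λ_p` are linearly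
dependent. -/
def IsSimple (p : ℝ) (Φ : X → ℝ≥0∞) : Prop :=
  ∀ u v : X, u ≠ 0 → v ≠ 0 →
    leastRayleigh p Φ = rayleigh p Φ u → leastRayleigh p Φ = rayleigh p Φ v →
      ¬ LinearIndependent ℝ ![u, v]

/-- `w` is a minimizer of `Φ(u) / ‖u‖ ^ p` over nonzero vectors. -/
def IsRayleighMinimizer (p : ℝ) (Φ : X → ℝ≥0∞) (w : X) : Prop :=
  w ≠ 0 ∧ ∀ u : X, u ≠ 0 → Φ w / ‖w‖ₑ ^ p ≤ Φ u / ‖u‖ₑ ^ p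

/-- Locally absolutely continuous paths `[0, ∞) → X`: on each `[0, T]` the increments are bounded by
the integrals of an integrable function. -/
def LocallyAbsCont (v : ℝ → X) : Prop :=
  ∀ T : ℝ, 0 < T → ∃ h : ℝ → ℝ, IntegrableOn h (Icc 0 T) ∧
    ∀ s t : ℝ, 0 ≤ s → s ≤ t → t ≤ T → ‖v t - v s‖ ≤ ∫ τ in s..t, h τ

/-- The metric derivative `|v̇|(t) = lim_{h → 0} ‖v (t + h) - v t‖ / |h|`.  For a locally absolutely
continuous path the limit exists at almost every `t > 0`. -/
def metricDeriv (v : ℝ → X) (t : ℝ) : ℝ :=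
  limUnder (𝓝[≠] (0 : ℝ)) fun h : ℝ => ‖v (t + h) - v t‖ / |h|

open Classical in
/-- The local slope `|∂Φ|(u) = limsup_{z → 0} (Φ(u) - Φ(u + z))⁺ / ‖z‖` for `u` in the domain of
`Φ`, and `∞` outside the domain.  Subtraction in `[0, ∞]` is truncated, so it is the positive
part. -/
def localSlope (Φ : X → ℝ≥0∞) (u : X) : ℝ≥0∞ :=
  if Φ u = ⊤ then ⊤
  else limsup (fun z : X => (Φ u - Φ (u + z)) / ‖z‖ₑ) (𝓝[≠] (0 : X))

/-- `v : [0, ∞) → X` is a `p`-curve of maximal slope for `Φ` (values of `v` at negative times are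
irrelevant): it is locally absolutely continuous, `Φ ∘ v` is nonincreasing and, at almost
every `t > 0`, `d/dt Φ(v(t)) ≤ - |v̇|(t) ^ p / p - |∂Φ|(v(t)) ^ q / q` with `q = p / (p - 1)`.
The inequality between real numbers includes that `Φ(v(t))` and `|∂Φ|(v(t))` are finite and that
the derivative exists. -/
structure IsCurveOfMaximalSlope (p : ℝ) (Φ : X → ℝ≥0∞) (v : ℝ → X) : Prop where
  locallyAbsCont : LocallyAbsCont v
  antitone : AntitoneOn (fun t => Φ (v t)) (Ici 0)
  slope : ∀ᵐ t ∂(volume.restrict (Ioi (0 : ℝ))),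
    Φ (v t) < ⊤ ∧ localSlope Φ (v t) < ⊤ ∧
    DifferentiableAt ℝ (fun s => (Φ (v s)).toReal) t ∧
    deriv (fun s => (Φ (v s)).toReal) t ≤
      - (1 / p) * metricDeriv v t ^ p
        - (1 / (p / (p - 1))) * (localSlope Φ (v t)).toReal ^ (p / (p - 1))

end RayleighFlow

end

/-! Write φ = Φ ∘ v, μ = μ_p, q = p/(p-1). The chain rule -φ' ≤ |∂Φ|(v)·|v̇| forces equality in
Young's inequality, so -φ' dominates both |v̇|^p and |∂Φ|(v)^q
(`IsCurveOfMaximalSlope.ae_le_dissipation`). Only monotonicity of φ is available, but ∫ -φ' ≤ φ(s) -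
φ(t) is the direction needed throughout.

Moving u towards the origin gives the Euler inequality pΦ(u) ≤ |∂Φ|(u)‖u‖. With λ_p‖u‖^p ≤ pΦ(u) it
yields -φ' ≥ pμφ, so the energy of the rescaled path e^{μt}v(t) is nonincreasing
(`IsCurveOfMaximalSlope.antitoneOn_rescaled`) and tends to some S.

At a cluster point w of the rescaled path, lower semicontinuity gives Φ(w) ≤ S. The decisive reverse
bound pS ≤ λ_p‖w‖^p (`IsCurveOfMaximalSlope.limit_energy_le`) comes from integrating the Euler
inequality over [s, s+δ], with s → ∞ and then δ → 0: a smaller norm would make the energy decay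
faster than e^{-pμt}. Hence pS = λ_p‖w‖^p = pΦ(w). Compact sublevels supply cluster points. They all
have the same norm and minimize the Rayleigh quotient if nonzero, so simplicity leaves only ±w, and
connectedness of the tail of the path fixes the sign. -/

namespace RayleighFlow

/-! ### Existence of the metric derivative. -/

section MetricDerivative

variable {X : Type*} [NormedAddCommGroup X]

theorem absolutelyContinuousOnInterval_of_dist_le {Y Z : Type*} [PseudoMetricSpace Y]
    [PseudoMetricSpace Z] {f : ℝ → Y} {g : ℝ → Z} {a b : ℝ}
    (hg : AbsolutelyContinuousOnInterval g a b)
    (h : ∀ x ∈ uIcc a b, ∀ y ∈ uIcc a b, dist (f x) (f y) ≤ dist (g x) (g y)) :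
    AbsolutelyContinuousOnInterval f a b := by
  rw [absolutelyContinuousOnInterval_iff] at hg ⊢
  intro ε hε
  obtain ⟨δ, hδ, H⟩ := hg ε hε
  refine ⟨δ, hδ, fun E hE hlt => (Finset.sum_le_sum fun i hi => ?_).trans_lt (H E hE hlt)⟩
  exact h _ (hE.1 i hi).1 _ (hE.1 i hi).2

/-- A path dominated on `[0, T]` by an absolutely continuous real function. -/
theorem LocallyAbsCont.exists_dominating {v : ℝ → X} (hv : LocallyAbsCont v) {T : ℝ}
    (hT : 0 < T) : ∃ H : ℝ → ℝ, AbsolutelyContinuousOnInterval H 0 T ∧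
      ∀ x ∈ Icc 0 T, ∀ y ∈ Icc 0 T, dist (v x) (v y) ≤ dist (H x) (H y) := by
  obtain ⟨h, hi, hh⟩ := hv T hT
  have hint : IntervalIntegrable h volume 0 T :=
    (intervalIntegrable_iff_integrableOn_Icc_of_le hT.le).2 hi
  have key : ∀ x ∈ Icc 0 T, ∀ y ∈ Icc 0 T, x ≤ y →
      dist (v y) (v x) ≤ dist (∫ τ in (0 : ℝ)..y, h τ) (∫ τ in (0 : ℝ)..x, h τ) := by
    intro x hx y hy hxy
    rw [dist_eq_norm, Real.dist_eq, intervalIntegral.integral_interval_sub_left]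
    · exact (hh x y hx.1 hxy hy.2).trans (le_abs_self _)
    · exact hint.mono_set (by rw [uIcc_of_le hy.1, uIcc_of_le hT.le]; exact Icc_subset_Icc_right hy.2)
    · exact hint.mono_set (by rw [uIcc_of_le hx.1, uIcc_of_le hT.le]; exact Icc_subset_Icc_right hx.2)
  refine ⟨fun x => ∫ τ in (0 : ℝ)..x, h τ,
    hint.absolutelyContinuousOnInterval_intervalIntegral (c := 0) (by simp), ?_⟩
  intro x hx y hy
  rcases le_total x y with hxy | hxy
  · rw [dist_comm, dist_comm (∫ τ in (0 : ℝ)..x, h τ)]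
    exact key x hx y hy hxy
  · exact key y hy x hx hxy

theorem LocallyAbsCont.absolutelyContinuousOnInterval_dist {v : ℝ → X} (hv : LocallyAbsCont v)
    {T : ℝ} (hT : 0 < T) (z : X) :
    AbsolutelyContinuousOnInterval (fun t => dist (v t) z) 0 T := by
  obtain ⟨H, hH, hd⟩ := hv.exists_dominating hT
  refine absolutelyContinuousOnInterval_of_dist_le hH fun x hx y hy => ?_
  rw [uIcc_of_le hT.le] at hx hy
  exact (dist_dist_dist_le_left _ _ _).trans (hd x hx y hy)

theorem LocallyAbsCont.continuousOn {v : ℝ → X} (hv : LocallyAbsCont v) :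
    ContinuousOn v (Ici 0) := by
  intro t ht
  have hT : 0 < t + 1 := by linarith [mem_Ici.1 ht]
  have := (hv.absolutelyContinuousOnInterval_dist hT (v t)).continuousOn
  rw [uIcc_of_le hT.le] at this
  have h2 := this t ⟨ht, by linarith⟩
  have h3 : ContinuousWithinAt v (Icc 0 (t + 1)) t := by
    rw [ContinuousWithinAt, tendsto_iff_dist_tendsto_zero]
    simpa [ContinuousWithinAt] using h2
  refine h3.mono_of_mem_nhdsWithin ?_
  exact mem_nhdsWithin.2 ⟨Iio (t + 1), isOpen_Iio, by simp, fun x hx => ⟨hx.2, hx.1.le⟩⟩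

theorem tendsto_abs_slope_of_hasDerivAt {d : ℝ → ℝ} {t d' : ℝ} (h : HasDerivAt d d' t) :
    Tendsto (fun h : ℝ => |d (t + h) - d t| / |h|) (𝓝[≠] (0 : ℝ)) (𝓝 |d'|) := by
  have := (hasDerivAt_iff_tendsto_slope_zero.1 h).abs
  refine this.congr fun x => ?_
  rw [smul_eq_mul, abs_mul, abs_inv, div_eq_inv_mul]

/-- The limit is the supremum m of |D_n'|, where D_n is the distance to the n-th of countably many
times dense in [0, T]. Each D_n bounds the difference quotients from below. Conversely the
increments of v are at most ∫ m, and Lebesgue differentiation bounds the quotients from above. -/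
theorem LocallyAbsCont.ae_exists_metricDeriv_Ioo {v : ℝ → X} (hv : LocallyAbsCont v) {T : ℝ}
    (hT : 0 < T) : ∀ᵐ t : ℝ, t ∈ Ioo 0 T →
      ∃ L, Tendsto (fun h : ℝ => ‖v (t + h) - v t‖ / |h|) (𝓝[≠] (0 : ℝ)) (𝓝 L) := by
  obtain ⟨H, hH, hd⟩ := hv.exists_dominating hT
  have : Nonempty (Icc (0 : ℝ) T) := ⟨⟨0, by simp [hT.le]⟩⟩
  set r : ℕ → Icc (0 : ℝ) T := TopologicalSpace.denseSeq (Icc (0 : ℝ) T) with hr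
  set D : ℕ → ℝ → ℝ := fun n t => dist (v t) (v (r n)) with hD
  have hDac : ∀ n, AbsolutelyContinuousOnInterval (D n) 0 T := fun n =>
    hv.absolutelyContinuousOnInterval_dist hT _
  have hIcc : uIcc 0 T = Icc 0 T := uIcc_of_le hT.le
  set m : ℝ → ℝ := fun t => ⨆ n, |deriv (D n) t| with hm
  have hDH : ∀ n t, t ∈ Ioo 0 T → DifferentiableAt ℝ (D n) t → DifferentiableAt ℝ H t →
      |deriv (D n) t| ≤ |deriv H t| := by
    intro n t ht h1 h2
    refine le_of_tendsto_of_tendsto (tendsto_abs_slope_of_hasDerivAt h1.hasDerivAt)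
      (tendsto_abs_slope_of_hasDerivAt h2.hasDerivAt) ?_
    have : ∀ᶠ h in 𝓝[≠] (0 : ℝ), t + h ∈ Ioo 0 T := by
      have : Tendsto (fun h : ℝ => t + h) (𝓝[≠] 0) (𝓝 (t + 0)) :=
        (Continuous.tendsto (by fun_prop) 0).mono_left nhdsWithin_le_nhds
      rw [add_zero] at this
      exact this.eventually (isOpen_Ioo.mem_nhds ht)
    filter_upwards [this] with h hh
    have h3 := (dist_dist_dist_le_left (v (t + h)) (v t) (v (r n))).trans
      (hd _ (Ioo_subset_Icc_self hh) _ (Ioo_subset_Icc_self ht))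
    rw [Real.dist_eq, Real.dist_eq] at h3
    gcongr
  have hmH : ∀ᵐ t : ℝ, t ∈ Ioo 0 T →
      (∀ n, DifferentiableAt ℝ (D n) t) ∧ ∀ n, |deriv (D n) t| ≤ |deriv H t| := by
    have h1 := ae_all_iff.2 fun n => (hDac n).ae_differentiableAt
    filter_upwards [h1, hH.ae_differentiableAt] with t h1 h2 ht
    have ht' : t ∈ uIcc 0 T := hIcc ▸ Ioo_subset_Icc_self ht
    exact ⟨fun n => h1 n ht', fun n => hDH n t ht (h1 n ht') (h2 ht')⟩
  have hmeas : Measurable m := Measurable.iSup fun n => (measurable_deriv (D n)).norm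
  have hmint : IntervalIntegrable m volume 0 T := by
    refine hH.intervalIntegrable_deriv.mono_fun hmeas.aestronglyMeasurable ?_
    rw [uIoc_of_le hT.le, ← restrict_Ioo_eq_restrict_Ioc, EventuallyLE,
      ae_restrict_iff' measurableSet_Ioo]
    filter_upwards [hmH] with t ht h
    rw [Real.norm_eq_abs, Real.norm_eq_abs, abs_of_nonneg (Real.iSup_nonneg fun n => abs_nonneg _)]
    exact ciSup_le (ht h).2
  have hsub : ∀ {s t : ℝ}, s ∈ Icc 0 T → t ∈ Icc 0 T → uIcc s t ⊆ uIcc 0 T := fun hs ht => by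
    rw [hIcc]; exact uIcc_subset_Icc hs ht
  have hDm : ∀ n s t, s ∈ Icc 0 T → t ∈ Icc 0 T → s ≤ t →
      |D n t - D n s| ≤ ∫ x in s..t, m x := by
    intro n s t hs ht hst
    rw [← ((hDac n).mono (hsub hs ht)).integral_deriv_eq_sub, ← Real.norm_eq_abs]
    refine intervalIntegral.norm_integral_le_of_norm_le hst ?_ (hmint.mono_set (hsub hs ht))
    have : ∀ᵐ x : ℝ, x ≠ T := by simp [ae_iff, measure_singleton]
    filter_upwards [hmH, this] with x hx hxT hxs
    have hx' : x ∈ Ioo 0 T := ⟨hs.1.trans_lt hxs.1, lt_of_le_of_ne (hxs.2.trans ht.2) hxT⟩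
    exact le_ciSup (f := fun n => |deriv (D n) x|) ⟨|deriv H x|, by
      rintro _ ⟨k, rfl⟩; exact (hx hx').2 k⟩ n
  -- By density the bound on D_n(t) - D_n(s) extends to every reference time τ; τ = s gives the
  -- claim.
  have hvm : ∀ s t, s ∈ Icc 0 T → t ∈ Icc 0 T → s ≤ t → dist (v t) (v s) ≤ ∫ x in s..t, m x := by
    intro s t hs ht hst
    have hcont : Continuous fun τ : Icc (0 : ℝ) T => dist (v t) (v τ) - dist (v s) (v τ) := by
      have : Continuous fun τ : Icc (0 : ℝ) T => v τ :=
        (hv.continuousOn.mono Icc_subset_Ici_self).domRestrict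
      exact (continuous_const.dist this).sub (continuous_const.dist this)
    have hcl : IsClosed {τ : Icc (0 : ℝ) T | dist (v t) (v τ) - dist (v s) (v τ) ≤ ∫ x in s..t, m x} :=
      isClosed_le hcont continuous_const
    have := (TopologicalSpace.denseRange_denseSeq (Icc (0 : ℝ) T)).closure_range ▸
      (hcl.closure_subset_iff.2 (by
        rintro _ ⟨n, rfl⟩
        exact (le_abs_self _).trans (hDm n s t hs ht hst)) :
        closure (range r) ⊆ _)
    simpa using this (mem_univ (⟨s, hs⟩ : Icc (0 : ℝ) T))
  filter_upwards [hmH, hmint.ae_hasDerivAt_integral] with t h1 h2 ht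
  have htI := Ioo_subset_Icc_self ht
  have hM := h2 (hIcc ▸ htI) 0 (by simp)
  have hup := tendsto_abs_slope_of_hasDerivAt hM
  have hm0 : 0 ≤ m t := Real.iSup_nonneg fun n => abs_nonneg _
  rw [abs_of_nonneg hm0] at hup
  refine ⟨m t, tendsto_order.2 ⟨fun c hc => ?_, fun c hc => ?_⟩⟩
  · obtain ⟨n, hn⟩ := exists_lt_of_lt_ciSup hc
    have := (tendsto_abs_slope_of_hasDerivAt ((h1 ht).1 n).hasDerivAt).eventually_const_lt hn
    filter_upwards [this] with h hh
    refine hh.trans_le ?_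
    gcongr
    rw [← dist_eq_norm, ← Real.dist_eq]
    exact dist_dist_dist_le_left _ _ _
  · have : ∀ᶠ h in 𝓝[≠] (0 : ℝ), t + h ∈ Ioo 0 T := by
      have : Tendsto (fun h : ℝ => t + h) (𝓝[≠] 0) (𝓝 (t + 0)) :=
        (Continuous.tendsto (by fun_prop) 0).mono_left nhdsWithin_le_nhds
      rw [add_zero] at this
      exact this.eventually (isOpen_Ioo.mem_nhds ht)
    filter_upwards [hup.eventually_lt_const hc, this] with h hh hT'
    refine lt_of_le_of_lt ?_ hh
    gcongr
    have hi : ∀ x ∈ Icc 0 T, IntervalIntegrable m volume 0 x := fun x hx =>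
      hmint.mono_set (hsub (by simp [hT.le]) hx)
    have hT'' := Ioo_subset_Icc_self hT'
    rw [intervalIntegral.integral_interval_sub_left (hi _ hT'') (hi _ htI), ← dist_eq_norm]
    rcases le_total t (t + h) with hle | hle
    · exact (hvm _ _ htI hT'' hle).trans (le_abs_self _)
    · rw [dist_comm, intervalIntegral.integral_symm, abs_neg]
      exact (hvm _ _ hT'' htI hle).trans (le_abs_self _)

/-- The metric derivative of a locally absolutely continuous path exists almost everywhere. -/
theorem LocallyAbsCont.ae_tendsto_metricDeriv {v : ℝ → X} (hv : LocallyAbsCont v) :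
    ∀ᵐ t : ℝ, 0 < t →
      Tendsto (fun h : ℝ => ‖v (t + h) - v t‖ / |h|) (𝓝[≠] (0 : ℝ)) (𝓝 (metricDeriv v t)) := by
  filter_upwards [ae_all_iff.2 fun n : ℕ => hv.ae_exists_metricDeriv_Ioo (T := n + 1)
    (by positivity)] with t ht h0
  obtain ⟨n, hn⟩ := exists_nat_gt t
  obtain ⟨L, hL⟩ := ht n ⟨h0, by linarith⟩
  rwa [metricDeriv, hL.limUnder_eq]

end MetricDerivative

/-! ### Real-valued forms of the Rayleigh quotient. -/

section Rayleigh

variable {X : Type*} [NormedAddCommGroup X] {p : ℝ} {Φ : X → ℝ≥0∞}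

theorem rayleigh_eq_ofReal (hp : 0 ≤ p) {u : X} (hu : u ≠ 0) (hf : Φ u ≠ ⊤) :
    rayleigh p Φ u = ENNReal.ofReal (p * (Φ u).toReal / ‖u‖ ^ p) := by
  have : 0 < ‖u‖ := norm_pos_iff.2 hu
  rw [rayleigh, ENNReal.ofReal_div_of_pos (by positivity), ENNReal.ofReal_mul hp,
    ENNReal.ofReal_toReal hf, ← ofReal_norm, ENNReal.ofReal_rpow_of_pos this]

theorem leastRayleigh_ne_top (hp : 0 ≤ p) {u : X} (hu : u ≠ 0) (hf : Φ u ≠ ⊤) :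
    leastRayleigh p Φ ≠ ⊤ := by
  refine ((iInf₂_le u hu).trans_lt (?_ : rayleigh p Φ u < ⊤)).ne
  rw [rayleigh_eq_ofReal hp hu hf]
  exact ENNReal.ofReal_lt_top

theorem toReal_leastRayleigh_mul_le (hp : 0 < p) {u : X} (hf : Φ u ≠ ⊤) :
    (leastRayleigh p Φ).toReal * ‖u‖ ^ p ≤ p * (Φ u).toReal := by
  by_cases hu : u = 0
  · rw [hu, norm_zero, Real.zero_rpow hp.ne', mul_zero]
    positivity
  have hn : 0 < ‖u‖ := norm_pos_iff.2 hu
  rw [← le_div_iff₀ (by positivity)]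
  refine ENNReal.toReal_le_of_le_ofReal (by positivity) ?_
  rw [← rayleigh_eq_ofReal hp.le hu hf]
  exact iInf₂_le u hu

theorem leastRayleigh_eq_rayleigh (hp : 0 < p) (hl : leastRayleigh p Φ ≠ ⊤) {w : X} (hw : w ≠ 0)
    (hf : Φ w ≠ ⊤) (h : (leastRayleigh p Φ).toReal * ‖w‖ ^ p = p * (Φ w).toReal) :
    leastRayleigh p Φ = rayleigh p Φ w := by
  have hn : 0 < ‖w‖ := norm_pos_iff.2 hw
  rw [rayleigh_eq_ofReal hp.le hw hf, ← h, mul_div_cancel_right₀ _ (by positivity),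
    ENNReal.ofReal_toReal hl]

theorem isRayleighMinimizer_of_eq (hp : 0 < p) {w : X} (hw : w ≠ 0)
    (h : leastRayleigh p Φ = rayleigh p Φ w) : IsRayleighMinimizer p Φ w := by
  refine ⟨hw, fun u hu => ?_⟩
  have : rayleigh p Φ w ≤ rayleigh p Φ u := h ▸ iInf₂_le u hu
  rw [rayleigh, rayleigh, mul_div_assoc, mul_div_assoc] at this
  exact (ENNReal.mul_le_mul_iff_right (by simpa using hp) ENNReal.ofReal_ne_top).1 this

end Rayleigh

/-! ### Consequences of homogeneity and compactness. -/

section Homogeneous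

variable {X : Type*} [NormedAddCommGroup X] [NormedSpace ℝ X] {p : ℝ} {Φ : X → ℝ≥0∞}

theorem IsAdmissible.apply_smul (hΦ : IsAdmissible p Φ) {c : ℝ} (hc : 0 ≤ c) (u : X) :
    Φ (c • u) = ENNReal.ofReal c ^ p * Φ u := by
  lift c to ℝ≥0 using hc
  rw [ENNReal.ofReal_coe_nnreal]
  exact hΦ.homogeneous c u

theorem IsAdmissible.toReal_apply_smul (hΦ : IsAdmissible p Φ) {c : ℝ} (hc : 0 ≤ c) (u : X) :
    (Φ (c • u)).toReal = c ^ p * (Φ u).toReal := by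
  rw [hΦ.apply_smul hc, ENNReal.toReal_mul, ← ENNReal.toReal_rpow, ENNReal.toReal_ofReal hc]

theorem IsAdmissible.apply_smul_ne_top (hΦ : IsAdmissible p Φ) (hp : 0 ≤ p) {c : ℝ} (hc : 0 ≤ c)
    {u : X} (hu : Φ u ≠ ⊤) : Φ (c • u) ≠ ⊤ := by
  rw [hΦ.apply_smul hc]
  exact ENNReal.mul_ne_top (ENNReal.rpow_ne_top_of_nonneg hp ENNReal.ofReal_ne_top) hu

theorem IsAdmissible.apply_zero (hΦ : IsAdmissible p Φ) (hp : 0 < p) : Φ 0 = 0 := by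
  obtain ⟨u, -⟩ := hΦ.proper
  simpa [hp] using hΦ.apply_smul le_rfl u

theorem IsAdmissible.exists_norm_rpow_le (hΦ : IsAdmissible p Φ) (hp : 0 < p) :
    ∃ R : ℝ, 0 < R ∧ ∀ u, Φ u ≠ ⊤ → ‖u‖ ^ p ≤ R ^ p * (Φ u).toReal := by
  obtain ⟨R, hR, hb⟩ := (hΦ.compact_sublevel 1).isBounded.exists_pos_norm_le
  refine ⟨R, hR, fun u hu => ?_⟩
  -- Scaling by c^(-1/p) moves u into the bounded sublevel {Φ ≤ 1}. Letting c decrease to Φ(u)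
  -- afterwards covers Φ(u) = 0.
  have key : ∀ c : ℝ, 0 < c → (Φ u).toReal ≤ c → ‖u‖ ^ p ≤ R ^ p * c := by
    intro c hc h
    have hd : (0 : ℝ) ≤ (c ^ (1 / p))⁻¹ := by positivity
    have hcp : (c ^ (1 / p)) ^ p = c := by
      rw [← Real.rpow_mul hc.le, one_div_mul_cancel hp.ne', Real.rpow_one]
    have hmem : Φ ((c ^ (1 / p))⁻¹ • u) ≤ (1 : ℝ≥0) := by
      rw [← ENNReal.toReal_le_toReal (hΦ.apply_smul_ne_top hp.le hd hu) ENNReal.coe_ne_top,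
        hΦ.toReal_apply_smul hd, Real.inv_rpow (by positivity), hcp]
      simpa using inv_mul_le_one_of_le₀ h hc.le
    have := hb _ hmem
    rw [norm_smul, Real.norm_of_nonneg hd, inv_mul_le_iff₀ (by positivity)] at this
    calc ‖u‖ ^ p ≤ (c ^ (1 / p) * R) ^ p := by gcongr
      _ = R ^ p * c := by rw [Real.mul_rpow (by positivity) hR.le, hcp, mul_comm]
  have hlim : Tendsto (fun c : ℝ => R ^ p * c) (𝓝[>] (Φ u).toReal) (𝓝 (R ^ p * (Φ u).toReal)) :=
    (Continuous.tendsto (by fun_prop) _).mono_left nhdsWithin_le_nhds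
  refine ge_of_tendsto hlim ?_
  filter_upwards [self_mem_nhdsWithin] with c hc
  exact key c (ENNReal.toReal_nonneg.trans_lt hc) (le_of_lt hc)

theorem IsAdmissible.toReal_leastRayleigh_pos (hΦ : IsAdmissible p Φ) (hp : 0 < p)
    (ht : leastRayleigh p Φ ≠ ⊤) : 0 < (leastRayleigh p Φ).toReal := by
  obtain ⟨R, hR, h⟩ := hΦ.exists_norm_rpow_le hp
  have : ENNReal.ofReal (p / R ^ p) ≤ leastRayleigh p Φ := by
    refine le_iInf₂ fun u hu => ?_
    have hn : 0 < ‖u‖ := norm_pos_iff.2 hu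
    by_cases hf : Φ u = ⊤
    · have : rayleigh p Φ u = ⊤ := by
        rw [rayleigh, hf, ENNReal.mul_top (by simpa using hp), ENNReal.top_div_of_ne_top]
        exact ENNReal.rpow_ne_top_of_nonneg hp.le enorm_ne_top
      rw [this]
      exact le_top
    · rw [rayleigh_eq_ofReal hp.le hu hf]
      refine ENNReal.ofReal_le_ofReal ?_
      rw [div_le_div_iff₀ (by positivity) (by positivity)]
      nlinarith [h u hf]
  exact (by positivity : 0 < p / R ^ p).trans_le ((ENNReal.ofReal_le_iff_le_toReal ht).1 this)

end Homogeneous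

/-! ### Local slope: chain rule, Euler inequality, Young equality. -/

section Slope

variable {X : Type*} [NormedAddCommGroup X] {Φ : X → ℝ≥0∞}

theorem eventually_le_add_of_localSlope_lt {u : X} {c : ℝ} (hu : Φ u ≠ ⊤)
    (hc : localSlope Φ u < ENNReal.ofReal c) :
    ∀ᶠ z in 𝓝 (0 : X), Φ u ≤ Φ (u + z) + ENNReal.ofReal c * ‖z‖ₑ := by
  rw [localSlope, if_neg hu] at hc
  have h := eventually_lt_of_limsup_lt hc
  rw [eventually_nhdsWithin_iff] at h
  filter_upwards [h] with z hz
  by_cases h0 : z = 0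
  · simp [h0]
  · have := (hz h0).le
    rw [ENNReal.div_le_iff (by simpa using h0) enorm_ne_top, tsub_le_iff_left] at this
    exact this

/-- The chain-rule inequality `-(Φ ∘ γ)' ≤ |∂Φ|(γ) |γ̇|`. -/
theorem neg_deriv_le_localSlope_mul {γ : ℝ → X} {t f' a : ℝ}
    (hfin : ∀ᶠ s in 𝓝 t, Φ (γ s) ≠ ⊤) (hslope : localSlope Φ (γ t) ≠ ⊤)
    (hf : HasDerivAt (fun s => (Φ (γ s)).toReal) f' t)
    (ha : Tendsto (fun h : ℝ => ‖γ (t + h) - γ t‖ / |h|) (𝓝[≠] (0 : ℝ)) (𝓝 a)) :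
    -f' ≤ (localSlope Φ (γ t)).toReal * a := by
  have hadd : Tendsto (fun h : ℝ => t + h) (𝓝[>] 0) (𝓝 t) := by
    have : Tendsto (fun h : ℝ => t + h) (𝓝[>] 0) (𝓝 (t + 0)) :=
      (Continuous.tendsto (by fun_prop) 0).mono_left nhdsWithin_le_nhds
    rwa [add_zero] at this
  have hle : 𝓝[>] (0 : ℝ) ≤ 𝓝[≠] 0 := nhdsWithin_mono _ fun x hx => ne_of_gt hx
  have hcont : Tendsto (fun h => γ (t + h) - γ t) (𝓝[>] 0) (𝓝 0) := by
    rw [tendsto_zero_iff_norm_tendsto_zero]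
    have h1 : Tendsto (fun h : ℝ => |h|) (𝓝[>] 0) (𝓝 0) := by
      have := (continuous_abs.tendsto (0 : ℝ)).mono_left (nhdsWithin_le_nhds (s := Ioi 0))
      simpa using this
    have h2 := (ha.mono_left hle).mul h1
    rw [mul_zero] at h2
    refine h2.congr' ?_
    filter_upwards [self_mem_nhdsWithin] with h hh
    have : |h| ≠ 0 := abs_ne_zero.2 (ne_of_gt hh)
    field_simp
  have hd := (hasDerivAt_iff_tendsto_slope_zero.1 hf).mono_left hle
  have key : ∀ c, (localSlope Φ (γ t)).toReal < c → -f' ≤ c * a := by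
    intro c hc
    have hc0 : 0 ≤ c := ENNReal.toReal_nonneg.trans hc.le
    have h1 := hcont.eventually (eventually_le_add_of_localSlope_lt hfin.self_of_nhds
      ((ENNReal.lt_ofReal_iff_toReal_lt hslope).2 hc))
    refine le_of_tendsto_of_tendsto hd.neg ((ha.mono_left hle).const_mul c) ?_
    filter_upwards [h1, hadd.eventually hfin, self_mem_nhdsWithin] with h h1 h2 h3
    have h0 : 0 < h := h3
    rw [add_sub_cancel] at h1
    have h4 := ENNReal.toReal_mono
      (ENNReal.add_ne_top.2 ⟨h2, ENNReal.mul_ne_top ENNReal.ofReal_ne_top enorm_ne_top⟩) h1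
    rw [ENNReal.toReal_add h2 (ENNReal.mul_ne_top ENNReal.ofReal_ne_top enorm_ne_top),
      ENNReal.toReal_mul, ENNReal.toReal_ofReal hc0, toReal_enorm] at h4
    rw [abs_of_pos h0, smul_eq_mul, ← mul_div_assoc, inv_mul_eq_div, ← neg_div]
    gcongr
    linarith
  have hlim : Tendsto (fun c : ℝ => c * a) (𝓝[>] (localSlope Φ (γ t)).toReal)
      (𝓝 ((localSlope Φ (γ t)).toReal * a)) :=
    (Continuous.tendsto (by fun_prop) _).mono_left nhdsWithin_le_nhds
  refine ge_of_tendsto hlim ?_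
  filter_upwards [self_mem_nhdsWithin] with c hc using key c hc

/-- Euler's identity as an inequality: apply the chain rule at s = 0 to the segment s ↦ (1 - s)u,
which has speed ‖u‖ and energy (1 - s)^p Φ(u). -/
theorem IsAdmissible.mul_le_localSlope_mul_norm [NormedSpace ℝ X] {p : ℝ} (hΦ : IsAdmissible p Φ)
    (hp : 1 ≤ p) {u : X} (hu : Φ u ≠ ⊤) (hs : localSlope Φ u ≠ ⊤) :
    p * (Φ u).toReal ≤ (localSlope Φ u).toReal * ‖u‖ := by
  have hnn : ∀ᶠ s in 𝓝 (0 : ℝ), 0 ≤ 1 - s := by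
    filter_upwards [Iio_mem_nhds (zero_lt_one : (0 : ℝ) < 1)] with s hs
    linarith [mem_Iio.1 hs]
  have hd : HasDerivAt (fun s : ℝ => (Φ ((1 - s) • u)).toReal) (-(p * (Φ u).toReal)) 0 := by
    have h1 : HasDerivAt (fun s : ℝ => (1 - s) ^ p * (Φ u).toReal) (-(p * (Φ u).toReal)) 0 := by
      have := (((hasDerivAt_id (0 : ℝ)).const_sub 1).rpow_const (p := p) (Or.inr hp)).mul_const
        (Φ u).toReal
      simpa using this
    refine h1.congr_of_eventuallyEq ?_
    filter_upwards [hnn] with s hs using hΦ.toReal_apply_smul hs u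
  have := neg_deriv_le_localSlope_mul (Φ := Φ) (γ := fun s : ℝ => (1 - s) • u) (t := 0) (a := ‖u‖)
    (by filter_upwards [hnn] with s hs using hΦ.apply_smul_ne_top (by linarith) hs hu)
    (by simpa using hs) hd
    (by
      refine tendsto_const_nhds.congr' ?_
      filter_upwards [self_mem_nhdsWithin] with h hh
      have : |h| ≠ 0 := abs_ne_zero.2 hh
      rw [← sub_smul, norm_smul]
      simp [field])
  simpa using this

end Slope

/-- The equality case of Young's inequality. -/
theorem rpow_le_of_young {p a b y : ℝ} (hp : 1 < p) (ha : 0 ≤ a) (hb : 0 ≤ b)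
    (h1 : 1 / p * a ^ p + 1 / (p / (p - 1)) * b ^ (p / (p - 1)) ≤ y) (h2 : y ≤ a * b) :
    a ^ p ≤ y ∧ b ^ (p / (p - 1)) ≤ y := by
  have hp1 : 0 < p - 1 := by linarith
  have hp0 : 0 < p := by linarith
  set q := p / (p - 1) with hq
  have hq0 : 0 < q := by positivity
  have hpq : 1 / p + 1 / q = 1 := by rw [hq]; field_simp; ring
  have h := Real.geom_mean_eq_arith_mean_weighted_iff_of_pos (Finset.univ : Finset (Fin 2))
    ![1 / p, 1 / q] ![a ^ p, b ^ q]
    (by intro i _; fin_cases i <;> simp <;> positivity)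
    (by simpa using hpq) (by intro i _; fin_cases i <;> simp <;> positivity)
  have ea : (a ^ p) ^ (1 / p) = a := by
    rw [← Real.rpow_mul ha, mul_one_div_cancel hp0.ne', Real.rpow_one]
  have eb : (b ^ q) ^ (1 / q) = b := by
    rw [← Real.rpow_mul hb, mul_one_div_cancel hq0.ne', Real.rpow_one]
  simp only [Fin.prod_univ_two, Fin.sum_univ_two, Matrix.cons_val_zero, Matrix.cons_val_one,
    ea, eb] at h
  have hyoung : a * b ≤ 1 / p * a ^ p + 1 / q * b ^ q := by
    have := Real.geom_mean_le_arith_mean2_weighted (w₁ := 1 / p) (w₂ := 1 / q) (p₁ := a ^ p)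
      (p₂ := b ^ q) (by positivity) (by positivity) (by positivity) (by positivity) hpq
    rwa [ea, eb] at this
  -- Equality in the weighted mean inequality forces a^p = b^q, so the weighted sum equals either of
  -- them.
  have heq := h.1 (le_antisymm hyoung (h1.trans h2)) 0 (Finset.mem_univ _) 1 (Finset.mem_univ _)
  simp only [Matrix.cons_val_zero, Matrix.cons_val_one] at heq
  have : 1 / p * a ^ p + 1 / q * b ^ q = b ^ q := by
    rw [heq, ← add_mul, hpq, one_mul]
  exact ⟨by rw [heq]; linarith, by linarith⟩

/-! ### Integrating derivatives of functions that are merely monotone. -/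

section Integration

variable {f d : ℝ → ℝ} {s t : ℝ}

theorem intervalIntegrable_neg_deriv_of_antitoneOn (hst : s ≤ t) (hf : AntitoneOn f (Icc s t)) :
    IntervalIntegrable (fun τ => -deriv f τ) volume s t := by
  have := (MonotoneOn.intervalIntegrable_deriv (f := -f) (a := s) (b := t)
    (by rw [uIcc_of_le hst]; exact hf.neg))
  simpa [deriv.neg'] using this

theorem integral_neg_deriv_le_of_antitoneOn (hst : s ≤ t) (hf : AntitoneOn f (Icc s t)) :
    ∫ τ in s..t, -deriv f τ ≤ f s - f t := by
  have := (MonotoneOn.intervalIntegral_deriv_mem_uIcc (f := -f) (a := s) (b := t)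
    (by rw [uIcc_of_le hst]; exact hf.neg))
  have hle : f t ≤ f s := hf (left_mem_Icc.2 hst) (right_mem_Icc.2 hst) hst
  rw [uIcc_of_le (by simp only [Pi.neg_apply]; linarith)] at this
  have h2 := this.2
  simp only [deriv.neg', Pi.neg_apply] at h2
  linarith

/-- Integrating a differential inequality against the dissipation of a nonincreasing function. -/
theorem sub_le_of_deriv_le_dissipation (hst : s ≤ t) (hf : AntitoneOn f (Icc s t))
    (hd : AbsolutelyContinuousOnInterval d s t) {c K : ℝ} (hK : 0 ≤ K)
    (h : ∀ᵐ τ, τ ∈ Ioo s t → deriv d τ ≤ c + K * -deriv f τ) :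
    d t - d s ≤ c * (t - s) + K * (f s - f t) := by
  have hi := intervalIntegrable_neg_deriv_of_antitoneOn hst hf
  rw [← hd.integral_deriv_eq_sub]
  calc ∫ τ in s..t, deriv d τ ≤ ∫ τ in s..t, (c + K * -deriv f τ) := by
        refine intervalIntegral.integral_mono_ae_restrict hst hd.intervalIntegrable_deriv
          (intervalIntegrable_const.add (hi.const_mul K)) ?_
        rw [← restrict_Ioo_eq_restrict_Icc, EventuallyLE, ae_restrict_iff' measurableSet_Ioo]
        exact h
    _ = c * (t - s) + K * ∫ τ in s..t, -deriv f τ := by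
        rw [intervalIntegral.integral_add intervalIntegrable_const (hi.const_mul K),
          intervalIntegral.integral_const, intervalIntegral.integral_const_mul, smul_eq_mul,
          mul_comm]
    _ ≤ c * (t - s) + K * (f s - f t) := by
        gcongr
        exact integral_neg_deriv_le_of_antitoneOn hst hf

theorem mul_sub_le_of_le_dissipation (hst : s ≤ t) (hf : AntitoneOn f (Icc s t)) {c K : ℝ}
    (hK : 0 ≤ K) (h : ∀ᵐ τ, τ ∈ Ioo s t → c ≤ K * -deriv f τ) :
    c * (t - s) ≤ K * (f s - f t) := by
  have hd : AbsolutelyContinuousOnInterval (fun _ : ℝ => (0 : ℝ)) s t := by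
    rw [absolutelyContinuousOnInterval_iff]
    exact fun ε hε => ⟨1, one_pos, fun E _ _ => by simpa using hε⟩
  have := sub_le_of_deriv_le_dissipation (c := -c) hst hf hd hK
    (by filter_upwards [h] with τ hτ hm; simpa using neg_le_neg (hτ hm))
  linarith

end Integration

/-! ### Energy and distance estimates along the curve. -/

section Curve

variable {X : Type*} [NormedAddCommGroup X] {p : ℝ} {Φ : X → ℝ≥0∞} {v : ℝ → X}

theorem IsCurveOfMaximalSlope.apply_ne_top (hv : IsCurveOfMaximalSlope p Φ v)
    (hv0 : v 0 ∈ Dom Φ) {t : ℝ} (ht : 0 ≤ t) : Φ (v t) ≠ ⊤ :=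
  ((hv.antitone (mem_Ici.2 le_rfl) (mem_Ici.2 ht) ht).trans_lt hv0).ne

theorem IsCurveOfMaximalSlope.antitoneOn_toReal (hv : IsCurveOfMaximalSlope p Φ v)
    (hv0 : v 0 ∈ Dom Φ) : AntitoneOn (fun t => (Φ (v t)).toReal) (Ici 0) :=
  fun _ hs _ ht hst => ENNReal.toReal_mono (hv.apply_ne_top hv0 hs) (hv.antitone hs ht hst)

/-- Along a curve of maximal slope the dissipation dominates both `|v̇| ^ p` and `|∂Φ| ^ q`. -/
theorem IsCurveOfMaximalSlope.ae_le_dissipation (hv : IsCurveOfMaximalSlope p Φ v) (hp : 1 < p)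
    (hv0 : v 0 ∈ Dom Φ) :
    ∀ᵐ t : ℝ, 0 < t → localSlope Φ (v t) ≠ ⊤ ∧ 0 ≤ metricDeriv v t ∧
      Tendsto (fun h : ℝ => ‖v (t + h) - v t‖ / |h|) (𝓝[≠] (0 : ℝ)) (𝓝 (metricDeriv v t)) ∧
      metricDeriv v t ^ p ≤ -deriv (fun s => (Φ (v s)).toReal) t ∧
      (localSlope Φ (v t)).toReal ^ (p / (p - 1)) ≤ -deriv (fun s => (Φ (v s)).toReal) t := by
  have h1 := hv.slope
  rw [ae_restrict_iff' measurableSet_Ioi] at h1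
  filter_upwards [h1, hv.locallyAbsCont.ae_tendsto_metricDeriv] with t h1 h2 ht
  obtain ⟨-, hs, hd, hle⟩ := h1 ht
  have h2 := h2 ht
  have ha : 0 ≤ metricDeriv v t := ge_of_tendsto' h2 fun h => by positivity
  have hfin : ∀ᶠ s in 𝓝 t, Φ (v s) ≠ ⊤ := by
    filter_upwards [Ioi_mem_nhds ht] with s hs using hv.apply_ne_top hv0 (le_of_lt hs)
  have hchain := neg_deriv_le_localSlope_mul hfin hs.ne hd.hasDerivAt h2
  refine ⟨hs.ne, ha, h2, rpow_le_of_young hp ha ENNReal.toReal_nonneg ?_ ?_⟩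
  · linarith
  · linarith

/-- Either a ≤ κ, or (a/κ)^(p-1) ≥ 1. This bounds speed linearly by dissipation, with κ left free
for the later rescaling. -/
theorem le_add_rpow_of_nonneg {a : ℝ} (hp : 1 < p) (ha : 0 ≤ a) {κ : ℝ} (hκ : 0 < κ) :
    a ≤ κ + κ ^ (1 - p) * a ^ p := by
  rcases le_total a κ with h | h
  · have : 0 ≤ κ ^ (1 - p) * a ^ p := by positivity
    linarith
  · have h0 : 0 < a := hκ.trans_le h
    have h1 : κ ^ (1 - p) * a ^ p = a * (a / κ) ^ (p - 1) := by
      rw [Real.div_rpow h0.le hκ.le, show 1 - p = -(p - 1) by ring, Real.rpow_neg hκ.le,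
        Real.rpow_sub_one h0.ne']
      field_simp
    have h2 : 1 ≤ (a / κ) ^ (p - 1) := by
      apply Real.one_le_rpow _ (by linarith)
      rwa [one_le_div hκ]
    rw [h1]
    nlinarith

theorem IsCurveOfMaximalSlope.dist_le (hv : IsCurveOfMaximalSlope p Φ v) (hp : 1 < p)
    (hv0 : v 0 ∈ Dom Φ) {s t κ : ℝ} (hs : 0 ≤ s) (hst : s ≤ t) (hκ : 0 < κ) :
    dist (v t) (v s) ≤
      κ * (t - s) + κ ^ (1 - p) * ((Φ (v s)).toReal - (Φ (v t)).toReal) := by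
  rcases (hs.trans hst).eq_or_lt with h0 | ht
  · have : s = t := by linarith
    simp [this]
  have hac := (hv.locallyAbsCont.absolutelyContinuousOnInterval_dist ht (v s)).mono
    (c := s) (d := t) (by
      rw [uIcc_of_le hst, uIcc_of_le ht.le]
      exact Icc_subset_Icc_left hs)
  have hf : AntitoneOn (fun t => (Φ (v t)).toReal) (Icc s t) :=
    (hv.antitoneOn_toReal hv0).mono fun x hx => hs.trans hx.1
  have := sub_le_of_deriv_le_dissipation (c := κ) (K := κ ^ (1 - p)) hst hf hac (by positivity) ?_
  · simpa using this
  have hu : uIcc s t = Icc s t := uIcc_of_le hst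
  filter_upwards [hv.ae_le_dissipation hp hv0, hac.ae_differentiableAt] with τ h1 h2 hτ
  obtain ⟨-, ha, hm, hap, -⟩ := h1 (hs.trans_lt hτ.1)
  have hd := (h2 (hu ▸ Ioo_subset_Icc_self hτ)).hasDerivAt
  have : |deriv (fun t => dist (v t) (v s)) τ| ≤ metricDeriv v τ := by
    refine le_of_tendsto_of_tendsto' (tendsto_abs_slope_of_hasDerivAt hd) hm fun h => ?_
    gcongr
    rw [← Real.dist_eq, ← dist_eq_norm]
    exact dist_dist_dist_le_left _ _ _
  calc _ ≤ metricDeriv v τ := (le_abs_self _).trans this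
    _ ≤ κ + κ ^ (1 - p) * metricDeriv v τ ^ p := le_add_rpow_of_nonneg hp ha hκ
    _ ≤ _ := by gcongr

theorem rate_nonneg : 0 ≤ rate p Φ := Real.rpow_nonneg ENNReal.toReal_nonneg _

theorem rate_rpow (hp : 1 < p) : rate p Φ ^ (p - 1) = (leastRayleigh p Φ).toReal := by
  rw [rate, ← Real.rpow_mul ENNReal.toReal_nonneg, one_div_mul_cancel (by linarith), Real.rpow_one]

variable [NormedSpace ℝ X]

/-- The Euler inequality raised to the power q and integrated; on [s, t] the energy is at least its
final value and the norm at most M. -/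
theorem IsCurveOfMaximalSlope.rpow_mul_sub_le (hv : IsCurveOfMaximalSlope p Φ v)
    (hΦ : IsAdmissible p Φ) (hp : 1 < p) (hv0 : v 0 ∈ Dom Φ) {s t M : ℝ} (hs : 0 ≤ s)
    (hst : s ≤ t) (hM : ∀ τ ∈ Icc s t, ‖v τ‖ ≤ M) :
    (p * (Φ (v t)).toReal) ^ (p / (p - 1)) * (t - s) ≤
      M ^ (p / (p - 1)) * ((Φ (v s)).toReal - (Φ (v t)).toReal) := by
  have hp1 : 0 < p - 1 := by linarith
  have hM0 : 0 ≤ M := (norm_nonneg _).trans (hM s (left_mem_Icc.2 hst))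
  have hanti := hv.antitoneOn_toReal hv0
  refine mul_sub_le_of_le_dissipation (f := fun t => (Φ (v t)).toReal) hst
    (hanti.mono fun x hx => hs.trans hx.1) (by positivity) ?_
  filter_upwards [hv.ae_le_dissipation hp hv0] with τ h1 hτ
  have hτ0 : 0 < τ := hs.trans_lt hτ.1
  obtain ⟨hsl, -, -, -, hb⟩ := h1 hτ0
  calc (p * (Φ (v t)).toReal) ^ (p / (p - 1))
      ≤ (M * (localSlope Φ (v τ)).toReal) ^ (p / (p - 1)) := by
        refine Real.rpow_le_rpow (by positivity) ?_ (by positivity)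
        calc p * (Φ (v t)).toReal ≤ p * (Φ (v τ)).toReal := by
              refine mul_le_mul_of_nonneg_left ?_ (by linarith)
              exact hanti hτ0.le (hs.trans hst) hτ.2.le
          _ ≤ (localSlope Φ (v τ)).toReal * ‖v τ‖ :=
              hΦ.mul_le_localSlope_mul_norm hp.le (hv.apply_ne_top hv0 hτ0.le) hsl
          _ ≤ M * (localSlope Φ (v τ)).toReal := by
              rw [mul_comm]
              refine mul_le_mul_of_nonneg_right ?_ ENNReal.toReal_nonneg
              exact hM τ (Ioo_subset_Icc_self hτ)
    _ = M ^ (p / (p - 1)) * (localSlope Φ (v τ)).toReal ^ (p / (p - 1)) :=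
        Real.mul_rpow hM0 ENNReal.toReal_nonneg
    _ ≤ _ := by gcongr

/-- With F = pΦ(u) and b = |∂Φ|(u), eliminate ‖u‖ from F ≤ b‖u‖ and λ_p‖u‖^p ≤ F to get λ_p F^(p-1)
≤ b^p; then take the power 1/(p-1). -/
theorem rate_mul_le_localSlope_rpow (hΦ : IsAdmissible p Φ) (hp : 1 < p) {u : X} (hu : Φ u ≠ ⊤)
    (hs : localSlope Φ u ≠ ⊤) :
    rate p Φ * (p * (Φ u).toReal) ≤ (localSlope Φ u).toReal ^ (p / (p - 1)) := by
  have hp1 : 0 < p - 1 := by linarith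
  have hp0 : 0 < p := by linarith
  set b := (localSlope Φ u).toReal with hbdef
  have hb : 0 ≤ b := ENNReal.toReal_nonneg
  set F := p * (Φ u).toReal with hF
  have hF0 : 0 ≤ F := by positivity
  rcases hF0.eq_or_lt with h0 | hFpos
  · rw [← h0, mul_zero]
    positivity
  set l := (leastRayleigh p Φ).toReal with hl
  have hl0 : 0 ≤ l := ENNReal.toReal_nonneg
  have h1 : F ≤ b * ‖u‖ := hΦ.mul_le_localSlope_mul_norm hp.le hu hs
  have h2 : l * ‖u‖ ^ p ≤ F := toReal_leastRayleigh_mul_le hp0 hu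
  have h3 : l * F ^ (p - 1) ≤ b ^ p := by
    have : l * F ^ (p - 1) * F ≤ b ^ p * F := by
      calc l * F ^ (p - 1) * F = l * F ^ p := by
            rw [Real.rpow_sub_one hFpos.ne']
            field_simp
        _ ≤ l * (b * ‖u‖) ^ p := by gcongr
        _ = b ^ p * (l * ‖u‖ ^ p) := by rw [Real.mul_rpow hb (norm_nonneg _)]; ring
        _ ≤ b ^ p * F := by gcongr
    exact le_of_mul_le_mul_right this hFpos
  calc rate p Φ * F = (l * F ^ (p - 1)) ^ (1 / (p - 1)) := by
        rw [Real.mul_rpow hl0 (by positivity), ← Real.rpow_mul hF0, mul_one_div_cancel hp1.ne',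
          Real.rpow_one, rate]
    _ ≤ (b ^ p) ^ (1 / (p - 1)) := by gcongr
    _ = b ^ (p / (p - 1)) := by rw [← Real.rpow_mul hb, mul_one_div]

theorem IsCurveOfMaximalSlope.mul_one_add_le (hv : IsCurveOfMaximalSlope p Φ v)
    (hΦ : IsAdmissible p Φ) (hp : 1 < p) (hv0 : v 0 ∈ Dom Φ) {s t : ℝ} (hs : 0 ≤ s)
    (hst : s ≤ t) :
    (Φ (v t)).toReal * (1 + p * rate p Φ * (t - s)) ≤ (Φ (v s)).toReal := by
  have hanti := hv.antitoneOn_toReal hv0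
  have hr : 0 ≤ rate p Φ := rate_nonneg
  have := mul_sub_le_of_le_dissipation (f := fun t => (Φ (v t)).toReal) (K := 1)
    (c := rate p Φ * (p * (Φ (v t)).toReal)) hst
    (hanti.mono fun x hx => hs.trans hx.1) zero_le_one ?_
  · simp only [one_mul] at this
    linarith
  filter_upwards [hv.ae_le_dissipation hp hv0] with τ h1 hτ
  have hτ0 : 0 < τ := hs.trans_lt hτ.1
  obtain ⟨hsl, -, -, -, hb⟩ := h1 hτ0
  rw [one_mul]
  refine le_trans ?_ ((rate_mul_le_localSlope_rpow hΦ hp (hv.apply_ne_top hv0 hτ0.le) hsl).trans hb)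
  refine mul_le_mul_of_nonneg_left (mul_le_mul_of_nonneg_left ?_ (by linarith)) hr
  exact hanti hτ0.le (hs.trans hst) hτ.2.le

/-- Iterating the one-step estimate over n equal subintervals gives the factor (1 + r/n)^n, which
tends to e^r. This Euler scheme replaces Gronwall, so φ need not be absolutely continuous. -/
theorem IsCurveOfMaximalSlope.mul_exp_le (hv : IsCurveOfMaximalSlope p Φ v)
    (hΦ : IsAdmissible p Φ) (hp : 1 < p) (hv0 : v 0 ∈ Dom Φ) {s t : ℝ} (hs : 0 ≤ s)
    (hst : s ≤ t) :
    (Φ (v t)).toReal * Real.exp (p * rate p Φ * (t - s)) ≤ (Φ (v s)).toReal := by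
  set r := p * rate p Φ * (t - s) with hr
  have hr0 : 0 ≤ r := mul_nonneg (mul_nonneg (by linarith) rate_nonneg) (by linarith)
  have hstep : ∀ n : ℕ, 0 < n → (Φ (v t)).toReal * (1 + r / n) ^ n ≤ (Φ (v s)).toReal := by
    intro n hn
    have hn' : (0 : ℝ) < n := by exact_mod_cast hn
    have hind : ∀ k : ℕ, k ≤ n →
        (Φ (v (s + k * ((t - s) / n)))).toReal * (1 + r / n) ^ k ≤ (Φ (v s)).toReal := by
      intro k
      induction k with
      | zero => simp
      | succ k ih =>
        intro hk
        have hδ : 0 ≤ (t - s) / n := div_nonneg (by linarith) hn'.le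
        have h := hv.mul_one_add_le hΦ hp hv0 (s := s + k * ((t - s) / n))
          (t := s + (k + 1 : ℕ) * ((t - s) / n)) (by positivity) (by push_cast; nlinarith)
        have he : 1 + p * rate p Φ * (s + (k + 1 : ℕ) * ((t - s) / n) - (s + k * ((t - s) / n)))
            = 1 + r / n := by
          rw [hr]; push_cast; field_simp; ring
        rw [he] at h
        calc _ = ((Φ (v (s + (k + 1 : ℕ) * ((t - s) / n)))).toReal * (1 + r / n))
              * (1 + r / n) ^ k := by ring
          _ ≤ (Φ (v (s + k * ((t - s) / n)))).toReal * (1 + r / n) ^ k := by gcongr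
          _ ≤ _ := ih (by omega)
    have := hind n le_rfl
    rwa [mul_div_cancel₀ _ hn'.ne', add_sub_cancel] at this
  refine le_of_tendsto ((Real.tendsto_one_add_div_pow_exp r).const_mul _) ?_
  filter_upwards [eventually_gt_atTop 0] with n hn using hstep n hn

end Curve

/-! ### Limits of the rescaled path. -/

section Asymptotics

variable {X : Type*} [NormedAddCommGroup X] [NormedSpace ℝ X] {p : ℝ} {Φ : X → ℝ≥0∞} {v : ℝ → X}

/-- The rescaled path `t ↦ e ^ (μ_p t) v(t)`. -/
noncomputable def rescaled (p : ℝ) (Φ : X → ℝ≥0∞) (v : ℝ → X) (t : ℝ) : X :=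
  Real.exp (rate p Φ * t) • v t

theorem toReal_apply_rescaled (hΦ : IsAdmissible p Φ) (t : ℝ) :
    (Φ (rescaled p Φ v t)).toReal = Real.exp (rate p Φ * t) ^ p * (Φ (v t)).toReal :=
  hΦ.toReal_apply_smul (Real.exp_nonneg _) _

theorem IsCurveOfMaximalSlope.apply_rescaled_ne_top (hv : IsCurveOfMaximalSlope p Φ v)
    (hΦ : IsAdmissible p Φ) (hp : 1 < p) (hv0 : v 0 ∈ Dom Φ) {t : ℝ} (ht : 0 ≤ t) :
    Φ (rescaled p Φ v t) ≠ ⊤ :=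
  hΦ.apply_smul_ne_top (by linarith) (Real.exp_nonneg _) (hv.apply_ne_top hv0 ht)

theorem IsCurveOfMaximalSlope.antitoneOn_rescaled (hv : IsCurveOfMaximalSlope p Φ v)
    (hΦ : IsAdmissible p Φ) (hp : 1 < p) (hv0 : v 0 ∈ Dom Φ) :
    AntitoneOn (fun t => (Φ (rescaled p Φ v t)).toReal) (Ici 0) := by
  intro s hs t ht hst
  have h := hv.mul_exp_le hΦ hp hv0 hs hst
  simp only [toReal_apply_rescaled hΦ]
  calc _ = Real.exp (rate p Φ * s) ^ p *
        ((Φ (v t)).toReal * Real.exp (p * rate p Φ * (t - s))) := by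
        rw [← Real.exp_mul, ← Real.exp_mul, mul_comm (Φ (v t)).toReal, ← mul_assoc, ← Real.exp_add]
        ring_nf
    _ ≤ _ := by gcongr

theorem IsCurveOfMaximalSlope.exists_tendsto_rescaled (hv : IsCurveOfMaximalSlope p Φ v)
    (hΦ : IsAdmissible p Φ) (hp : 1 < p) (hv0 : v 0 ∈ Dom Φ) :
    ∃ S : ℝ, 0 ≤ S ∧ Tendsto (fun t => (Φ (rescaled p Φ v t)).toReal) atTop (𝓝 S) := by
  have hanti := hv.antitoneOn_rescaled hΦ hp hv0
  have h : Antitone fun t : ℝ => (Φ (rescaled p Φ v (max t 0))).toReal := fun s t hst =>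
    hanti (mem_Ici.2 (le_max_right _ _)) (mem_Ici.2 (le_max_right _ _)) (max_le_max hst le_rfl)
  have ht := tendsto_atTop_ciInf h ⟨0, by rintro _ ⟨t, rfl⟩; exact ENNReal.toReal_nonneg⟩
  refine ⟨_, Real.iInf_nonneg fun t => ENNReal.toReal_nonneg, ht.congr' ?_⟩
  filter_upwards [eventually_ge_atTop 0] with t ht
  rw [max_eq_left ht]

/-- `rpow_mul_sub_le` on [s, s + δ], multiplied through by powers of E = e^{μs}. The quantity A is
the energy of E·v(s + δ), with the scaling frozen at time s. -/
theorem IsCurveOfMaximalSlope.rescaled_dissipation (hv : IsCurveOfMaximalSlope p Φ v)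
    (hΦ : IsAdmissible p Φ) (hp : 1 < p) (hv0 : v 0 ∈ Dom Φ) {s δ A : ℝ} (hs : 0 ≤ s)
    (hδ : 0 ≤ δ)
    (hA : A = Real.exp (-(p * rate p Φ * δ)) * (Φ (rescaled p Φ v (s + δ))).toReal) :
    (p * A) ^ (p / (p - 1)) * δ ≤
      (‖rescaled p Φ v s‖ + δ + ((Φ (rescaled p Φ v s)).toReal - A)) ^ (p / (p - 1)) *
        ((Φ (rescaled p Φ v s)).toReal - A) := by
  have hp1 : 0 < p - 1 := by linarith
  have hp0 : 0 < p := by linarith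
  set E := Real.exp (rate p Φ * s) with hE
  have hE0 : 0 < E := Real.exp_pos _
  have hanti := hv.antitoneOn_toReal hv0
  set fs := (Φ (v s)).toReal with hfs
  set ft := (Φ (v (s + δ))).toReal with hft
  have hle : ft ≤ fs := hanti hs (mem_Ici.2 (by linarith)) (by linarith)
  have hA' : A = E ^ p * ft := by
    rw [hA, toReal_apply_rescaled hΦ, ← hft, hE, ← Real.exp_mul, ← Real.exp_mul, ← mul_assoc,
      ← Real.exp_add]
    ring_nf
  have hg : (Φ (rescaled p Φ v s)).toReal = E ^ p * fs := toReal_apply_rescaled hΦ s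
  have hw : ‖rescaled p Φ v s‖ = E * ‖v s‖ := by
    rw [rescaled, norm_smul, Real.norm_of_nonneg hE0.le]
  -- This is the bound from `dist_le` with κ = 1/E; since E·κ^(1-p) = E^p, the product E·M involves
  -- only rescaled quantities.
  set M := ‖v s‖ + (E⁻¹ * δ + E⁻¹ ^ (1 - p) * (fs - ft)) with hM
  have hM0 : 0 ≤ M := by
    have : 0 ≤ fs - ft := by linarith
    positivity
  have key := hv.rpow_mul_sub_le hΦ hp hv0 (M := M) hs (t := s + δ) (by linarith) (by
    intro τ hτ
    have h1 := hv.dist_le hp hv0 hs hτ.1 (inv_pos.2 hE0)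
    have h2 : ‖v τ‖ ≤ ‖v s‖ + dist (v τ) (v s) := by
      rw [dist_eq_norm]
      linarith [norm_sub_norm_le (v τ) (v s)]
    refine h2.trans (add_le_add_right (h1.trans ?_) _)
    have h3 : ft ≤ (Φ (v τ)).toReal :=
      hanti (hs.trans hτ.1) (mem_Ici.2 (by linarith)) hτ.2
    have h4 : τ - s ≤ δ := by linarith [hτ.2]
    gcongr)
  have hEM : ‖rescaled p Φ v s‖ + δ + (E ^ p * fs - E ^ p * ft) = E * M := by
    have : E⁻¹ ^ (1 - p) = E ^ p / E := by
      rw [Real.inv_rpow hE0.le, ← Real.rpow_neg hE0.le, neg_sub, Real.rpow_sub_one hE0.ne']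
    rw [hw, hM, this]
    field_simp
    ring
  rw [hg, hA', hEM, Real.mul_rpow hE0.le hM0, show p * (E ^ p * ft) = E ^ p * (p * ft) by ring,
    Real.mul_rpow (by positivity) (by positivity), ← Real.rpow_mul hE0.le,
    show p * (p / (p - 1)) = p / (p - 1) + p by field_simp; ring, Real.rpow_add hE0]
  rw [add_sub_cancel_left] at key
  calc _ = E ^ (p / (p - 1)) * E ^ p * ((p * ft) ^ (p / (p - 1)) * δ) := by ring
    _ ≤ E ^ (p / (p - 1)) * E ^ p * (M ^ (p / (p - 1)) * (fs - ft)) := by gcongr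
    _ = _ := by ring

theorem tendsto_one_sub_exp_div (c : ℝ) :
    Tendsto (fun δ : ℝ => (1 - Real.exp (-(c * δ))) / δ) (𝓝[>] 0) (𝓝 c) := by
  have h : HasDerivAt (fun δ : ℝ => -Real.exp (-(c * δ))) c 0 := by
    have := (((hasDerivAt_id (0 : ℝ)).const_mul c).neg.exp).neg
    simpa [Pi.neg_def] using this
  refine ((hasDerivAt_iff_tendsto_slope_zero.1 h).mono_left
    (nhdsWithin_mono _ fun x hx => ne_of_gt hx)).congr fun δ => ?_
  simp only [zero_add, mul_zero, neg_zero, Real.exp_zero, smul_eq_mul]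
  ring

theorem IsCurveOfMaximalSlope.limit_energy_le (hv : IsCurveOfMaximalSlope p Φ v)
    (hΦ : IsAdmissible p Φ) (hp : 1 < p) (hv0 : v 0 ∈ Dom Φ) {S : ℝ} (hS : 0 ≤ S)
    (hlim : Tendsto (fun t => (Φ (rescaled p Φ v t)).toReal) atTop (𝓝 S))
    {U : Filter ℝ} [U.NeBot] (hU : U ≤ atTop) {w : X} (hw : Tendsto (rescaled p Φ v) U (𝓝 w)) :
    p * S ≤ (leastRayleigh p Φ).toReal * ‖w‖ ^ p := by
  have hp1 : 0 < p - 1 := by linarith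
  have hp0 : 0 < p := by linarith
  have hq : 0 < p / (p - 1) := by positivity
  have hr : 0 ≤ rate p Φ := rate_nonneg
  set c := p * rate p Φ with hc
  -- First pass to the limit in s along U with δ fixed: both Φ(e^{μs}v(s)) and its shift by δ tend
  -- to S.
  have hδ : ∀ δ : ℝ, 0 < δ →
      (p * (Real.exp (-(c * δ)) * S)) ^ (p / (p - 1)) ≤
        (‖w‖ + δ + (S - Real.exp (-(c * δ)) * S)) ^ (p / (p - 1)) *
          (S * ((1 - Real.exp (-(c * δ))) / δ)) := by
    intro δ hδ
    have hA : Tendsto (fun s => Real.exp (-(c * δ)) * (Φ (rescaled p Φ v (s + δ))).toReal) U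
        (𝓝 (Real.exp (-(c * δ)) * S)) :=
      ((hlim.comp (tendsto_atTop_add_const_right _ δ tendsto_id)).mono_left hU).const_mul _
    have hg := hlim.mono_left hU
    have h := le_of_tendsto_of_tendsto
      (((hA.const_mul p).rpow_const (Or.inr hq.le)).mul_const δ)
      ((((hw.norm.add_const δ).add (hg.sub hA)).rpow_const (Or.inr hq.le)).mul (hg.sub hA))
      (by
        filter_upwards [hU (eventually_ge_atTop 0)] with s hs
        exact hv.rescaled_dissipation hΦ hp hv0 hs hδ.le rfl)
    rw [← le_div_iff₀ hδ] at h
    refine h.trans_eq ?_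
    ring
  have hexp : Tendsto (fun δ : ℝ => Real.exp (-(c * δ))) (𝓝[>] 0) (𝓝 1) := by
    have : Tendsto (fun δ : ℝ => Real.exp (-(c * δ))) (𝓝 0) (𝓝 (Real.exp (-(c * 0)))) :=
      Continuous.tendsto (by fun_prop) 0
    rw [mul_zero, neg_zero, Real.exp_zero] at this
    exact this.mono_left nhdsWithin_le_nhds
  have hid : Tendsto (fun δ : ℝ => δ) (𝓝[>] 0) (𝓝 0) := tendsto_id.mono_left nhdsWithin_le_nhds
  -- Now δ → 0, where (1 - e^{-cδ})/δ → c = pμ leaves (pS)^q ≤ ‖w‖^q·S·pμ.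
  have h0 := le_of_tendsto_of_tendsto
    (((hexp.mul_const S).const_mul p).rpow_const (Or.inr hq.le))
    ((((hid.const_add ‖w‖).add ((hexp.mul_const S).const_sub S)).rpow_const (Or.inr hq.le)).mul
      ((tendsto_one_sub_exp_div c).const_mul S))
    (by filter_upwards [self_mem_nhdsWithin] with δ h using hδ δ h)
  rw [one_mul, add_zero, sub_self, add_zero] at h0
  rcases hS.eq_or_lt with hS0 | hS0
  · rw [← hS0, mul_zero]
    positivity
  -- The power p - 1 turns q into p and μ into λ_p; cancelling (pS)^(p-1) then needs S > 0.
  have h1 : (p * S) ^ p ≤ ‖w‖ ^ p * ((p * S) ^ (p - 1) * (leastRayleigh p Φ).toReal) := by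
    calc (p * S) ^ p = ((p * S) ^ (p / (p - 1))) ^ (p - 1) := by
          rw [← Real.rpow_mul (by positivity), div_mul_cancel₀ _ hp1.ne']
      _ ≤ (‖w‖ ^ (p / (p - 1)) * (S * c)) ^ (p - 1) := by gcongr
      _ = ‖w‖ ^ p * ((p * S) ^ (p - 1) * (leastRayleigh p Φ).toReal) := by
          rw [Real.mul_rpow (by positivity) (by positivity), ← Real.rpow_mul (norm_nonneg _),
            div_mul_cancel₀ _ hp1.ne', ← rate_rpow hp, ← Real.mul_rpow (by positivity) hr]
          congr 2
          rw [hc]; ring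
  have h2 : (p * S) ^ p = p * S * (p * S) ^ (p - 1) := by
    rw [Real.rpow_sub_one (by positivity)]
    field_simp
  rw [h2] at h1
  refine le_of_mul_le_mul_right ?_ (by positivity : 0 < (p * S) ^ (p - 1))
  linarith

/-- The chain pS ≤ λ_p‖w‖^p ≤ pΦ(w) ≤ pS closes up; its last link is lower semicontinuity. -/
theorem IsCurveOfMaximalSlope.cluster_energy (hv : IsCurveOfMaximalSlope p Φ v)
    (hΦ : IsAdmissible p Φ) (hp : 1 < p) (hv0 : v 0 ∈ Dom Φ) {S : ℝ} (hS : 0 ≤ S)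
    (hlim : Tendsto (fun t => (Φ (rescaled p Φ v t)).toReal) atTop (𝓝 S))
    {U : Filter ℝ} [U.NeBot] (hU : U ≤ atTop) {w : X} (hw : Tendsto (rescaled p Φ v) U (𝓝 w)) :
    Φ w = ENNReal.ofReal S ∧ (leastRayleigh p Φ).toReal * ‖w‖ ^ p = p * S := by
  have hp0 : 0 < p := by linarith
  have hle : Φ w ≤ ENNReal.ofReal S := by
    by_contra! h
    obtain ⟨c, hSc, hc⟩ := exists_between h
    have h1 := hw.eventually (hΦ.lsc w c hc)
    have h2 := ((ENNReal.tendsto_ofReal hlim).mono_left hU).eventually_lt_const hSc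
    obtain ⟨t, h1, h2, ht⟩ := (h1.and (h2.and (hU (eventually_ge_atTop 0)))).exists
    rw [ENNReal.ofReal_toReal (hv.apply_rescaled_ne_top hΦ hp hv0 ht)] at h2
    exact lt_asymm h1 h2
  have hfin : Φ w ≠ ⊤ := ne_top_of_le_ne_top ENNReal.ofReal_ne_top hle
  have h1 := hv.limit_energy_le hΦ hp hv0 hS hlim hU hw
  have h2 : (leastRayleigh p Φ).toReal * ‖w‖ ^ p ≤ p * (Φ w).toReal :=
    toReal_leastRayleigh_mul_le hp0 hfin
  have h3 : (Φ w).toReal ≤ S := ENNReal.toReal_le_of_le_ofReal hS hle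
  have h4 : p * (Φ w).toReal ≤ p * S := by gcongr
  refine ⟨hle.antisymm ?_, by linarith⟩
  refine ENNReal.ofReal_le_of_le_toReal ?_
  exact le_of_mul_le_mul_left (h1.trans h2) hp0

theorem IsSimple.eq_or_eq_neg (hs : IsSimple p Φ) {u w : X} (hu : u ≠ 0) (hw : w ≠ 0) (hn : ‖u‖ = ‖w‖) (h1 : leastRayleigh p Φ = rayleigh p Φ u)
    (h2 : leastRayleigh p Φ = rayleigh p Φ w) : w = u ∨ w = -u := by
  have h := hs u w hu hw h1 h2
  rw [LinearIndependent.pair_iff' hu] at h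
  push Not at h
  obtain ⟨a, rfl⟩ := h
  rw [norm_smul] at hn
  have : ‖a‖ = 1 := by
    have : 0 < ‖u‖ := norm_pos_iff.2 hu
    nlinarith
  rcases eq_or_eq_neg_of_abs_eq this with rfl | rfl
  · simp
  · simp

/-- A continuous path whose ultrafilter limits exist and lie in `{w, -w}` converges, if one of its
limits is `w`. -/
theorem tendsto_of_ultrafilter_limits {x : ℝ → X} (hx : ContinuousOn x (Ici 0)) {w : X}
    (h : ∀ U : Ultrafilter ℝ, (U : Filter ℝ) ≤ atTop →
      Tendsto x U (𝓝 w) ∨ Tendsto x U (𝓝 (-w)))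
    (hw : ∃ U : Ultrafilter ℝ, (U : Filter ℝ) ≤ atTop ∧ Tendsto x U (𝓝 w)) :
    Tendsto x atTop (𝓝 w) := by
  obtain ⟨U₀, hU₀, hw⟩ := hw
  rcases eq_or_ne w 0 with rfl | h0
  · refine tendsto_iff_ultrafilter _ _ _ |>.2 fun U hU => ?_
    simpa using h U hU
  have hne : w ≠ -w := fun hh => h0 <| by
    have : (2 : ℝ) • w = 0 := by
      rw [two_smul]
      nth_rewrite 2 [hh]
      exact add_neg_cancel w
    exact (smul_eq_zero.1 this).resolve_left two_ne_zero
  obtain ⟨A, B, hA, hB, hwA, hwB, hAB⟩ := t2_separation hne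
  have hev : ∀ᶠ t in atTop, x t ∈ A ∪ B := by
    refine Filter.mem_iff_ultrafilter.2 fun U hU => ?_
    rcases h U hU with h | h
    · exact (h.eventually (hA.mem_nhds hwA)).mono fun t ht => Or.inl ht
    · exact (h.eventually (hB.mem_nhds hwB)).mono fun t ht => Or.inr ht
  obtain ⟨T, hT⟩ := eventually_atTop.1 (hev.and (eventually_ge_atTop 0))
  -- The connected tail lies in the disjoint open sets A ∪ B and meets A, so it never visits B.
  have hpre : IsPreconnected (x '' Ici T) :=
    isPreconnected_Ici.image x (hx.mono fun t ht => (hT t ht).2)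
  obtain ⟨t₀, ht₀, hT₀⟩ := ((hw.eventually (hA.mem_nhds hwA)).and
    (hU₀ (eventually_ge_atTop T))).exists
  have hsub : x '' Ici T ⊆ A := hpre.subset_left_of_subset_union hA hB hAB
    (by rintro _ ⟨t, ht, rfl⟩; exact (hT t ht).1) ⟨x t₀, ⟨t₀, hT₀, rfl⟩, ht₀⟩
  refine tendsto_iff_ultrafilter _ _ _ |>.2 fun U hU => ?_
  refine (h U hU).resolve_right fun hneg => ?_
  obtain ⟨t, h1, h2⟩ := ((hneg.eventually (hB.mem_nhds hwB)).and
    (hU (eventually_ge_atTop T))).exists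
  exact disjoint_left.1 hAB (hsub ⟨t, h2, rfl⟩) h1

theorem rayleigh_rescaled (hΦ : IsAdmissible p Φ) (hp : 0 < p) {t : ℝ} (hf : Φ (v t) ≠ ⊤)
    (h0 : rescaled p Φ v t ≠ 0) :
    rayleigh p Φ (v t) = ENNReal.ofReal
      (p * (Φ (rescaled p Φ v t)).toReal / ‖rescaled p Φ v t‖ ^ p) := by
  have hv : v t ≠ 0 := fun h => h0 (by rw [rescaled, h, smul_zero])
  have hn : 0 < ‖v t‖ := norm_pos_iff.2 hv
  have hE := Real.exp_pos (rate p Φ * t)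
  rw [rayleigh_eq_ofReal hp.le hv hf, toReal_apply_rescaled hΦ, rescaled, norm_smul,
    Real.norm_of_nonneg hE.le, Real.mul_rpow hE.le hn.le]
  congr 1
  field_simp

end Asymptotics

end RayleighFlow

/-! ### The convergence theorem. -/

open RayleighFlow in
theorem theorem2 {X : Type*} [NormedAddCommGroup X] [NormedSpace ℝ X] [CompleteSpace X]
    (p : ℝ) (hp : 1 < p) (Φ : X → ℝ≥0∞) (hΦ : RayleighFlow.IsAdmissible p Φ)
    (hsimple : RayleighFlow.IsSimple p Φ)
    (v : ℝ → X) (hv : RayleighFlow.IsCurveOfMaximalSlope p Φ v)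
    (hv0 : v 0 ∈ RayleighFlow.Dom Φ) :
    ∃ w : X,
      Tendsto (fun t : ℝ => Real.exp (RayleighFlow.rate p Φ * t) • v t) atTop (𝓝 w) ∧
      w ∈ RayleighFlow.Dom Φ ∧
      Tendsto (fun t : ℝ => Φ (Real.exp (RayleighFlow.rate p Φ * t) • v t)) atTop (𝓝 (Φ w)) ∧
      (w ≠ 0 →
        RayleighFlow.IsRayleighMinimizer p Φ w ∧
        Tendsto (fun t : ℝ => RayleighFlow.rayleigh p Φ (v t)) atTop
          (𝓝 (RayleighFlow.leastRayleigh p Φ))) := by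
  have hp0 : 0 < p := by linarith
  -- If λ_p = ∞, then Φ is infinite away from 0, so v vanishes on [0, ∞) and the value of `rate` is
  -- immaterial.
  by_cases hl : leastRayleigh p Φ = ⊤
  · have hz : ∀ᶠ t in atTop, v t = 0 := by
      filter_upwards [eventually_ge_atTop 0] with t ht
      by_contra h
      exact leastRayleigh_ne_top hp0.le h (hv.apply_ne_top hv0 ht) hl
    refine ⟨0, ?_, ?_, ?_, fun h => absurd rfl h⟩
    · exact tendsto_const_nhds.congr' (hz.mono fun t ht => by simp only [ht, smul_zero])
    · rw [Dom, mem_ofPred_eq, hΦ.apply_zero hp0]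
      exact ENNReal.zero_lt_top
    · exact tendsto_const_nhds.congr' (hz.mono fun t ht => by simp only [ht, smul_zero])
  have hlpos := hΦ.toReal_leastRayleigh_pos hp0 hl
  obtain ⟨S, hS, hlim⟩ := hv.exists_tendsto_rescaled hΦ hp hv0
  have hfin : ∀ t, 0 ≤ t → Φ (rescaled p Φ v t) ≠ ⊤ := fun t ht =>
    hv.apply_rescaled_ne_top hΦ hp hv0 ht
  have hclus : ∀ U : Ultrafilter ℝ, (U : Filter ℝ) ≤ atTop → ∀ w, Tendsto (rescaled p Φ v) U (𝓝 w) →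
      Φ w = ENNReal.ofReal S ∧ (leastRayleigh p Φ).toReal * ‖w‖ ^ p = p * S :=
    fun U hU w hw => hv.cluster_energy hΦ hp hv0 hS hlim hU hw
  have hcpt : ∀ U : Ultrafilter ℝ, (U : Filter ℝ) ≤ atTop →
      ∃ w, Tendsto (rescaled p Φ v) U (𝓝 w) := by
    intro U hU
    have hmem : ∀ᶠ t in (U : Filter ℝ), rescaled p Φ v t ∈
        {u | Φ u ≤ ((Φ (rescaled p Φ v 0)).toNNReal : ℝ≥0)} := by
      filter_upwards [hU (eventually_ge_atTop 0)] with t ht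
      rw [ENNReal.coe_toNNReal (hfin 0 le_rfl),
        ← ENNReal.toReal_le_toReal (hfin t ht) (hfin 0 le_rfl)]
      exact hv.antitoneOn_rescaled hΦ hp hv0 (mem_Ici.2 le_rfl) ht ht
    obtain ⟨w, -, hw⟩ := (hΦ.compact_sublevel _).ultrafilter_le_nhds (U.map (rescaled p Φ v))
      (le_principal_iff.2 hmem)
    exact ⟨w, hw⟩
  set U₀ : Ultrafilter ℝ := Ultrafilter.of atTop
  have hU₀ : (U₀ : Filter ℝ) ≤ atTop := Ultrafilter.of_le _
  obtain ⟨w, hw⟩ := hcpt U₀ hU₀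
  obtain ⟨hΦw, hnw⟩ := hclus U₀ hU₀ w hw
  have hmin : ∀ u : X, u ≠ 0 → Φ u = ENNReal.ofReal S →
      (leastRayleigh p Φ).toReal * ‖u‖ ^ p = p * S → leastRayleigh p Φ = rayleigh p Φ u :=
    fun u hu h1 h2 => leastRayleigh_eq_rayleigh hp0 hl hu (h1 ▸ ENNReal.ofReal_ne_top)
      (by rw [h1, ENNReal.toReal_ofReal hS, h2])
  -- Positivity of λ_p lets S determine the norm of every cluster point.
  have hnorm : ∀ u : X, (leastRayleigh p Φ).toReal * ‖u‖ ^ p = p * S → ‖w‖ = ‖u‖ := by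
    intro u hu
    have h := mul_left_cancel₀ hlpos.ne' (hnw.trans hu.symm)
    exact (Real.rpow_left_inj (norm_nonneg _) (norm_nonneg _) hp0.ne').1 h
  have hcont : ContinuousOn (rescaled p Φ v) (Ici 0) :=
    ContinuousOn.smul (by fun_prop) hv.locallyAbsCont.continuousOn
  have hconv : Tendsto (rescaled p Φ v) atTop (𝓝 w) := by
    refine tendsto_of_ultrafilter_limits hcont (fun U hU => ?_) ⟨U₀, hU₀, hw⟩
    obtain ⟨u, hu⟩ := hcpt U hU
    obtain ⟨hΦu, hnu⟩ := hclus U hU u hu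
    have huw := hnorm u hnu
    rcases eq_or_ne w 0 with h0 | h0
    · have : u = 0 := norm_eq_zero.1 (by rw [← huw, h0, norm_zero])
      exact Or.inl (by rwa [h0, ← this])
    · have hu0 : u ≠ 0 := norm_pos_iff.1 (huw ▸ norm_pos_iff.2 h0)
      rcases hsimple.eq_or_eq_neg h0 hu0 huw (hmin w h0 hΦw hnw) (hmin u hu0 hΦu hnu) with
        rfl | rfl
      · exact Or.inl hu
      · exact Or.inr hu
  refine ⟨w, hconv, ?_, ?_, fun h0 => ⟨isRayleighMinimizer_of_eq hp0 h0 (hmin w h0 hΦw hnw), ?_⟩⟩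
  · rw [Dom, mem_ofPred_eq, hΦw]
    exact ENNReal.ofReal_lt_top
  · rw [hΦw]
    refine (ENNReal.tendsto_ofReal hlim).congr' ?_
    filter_upwards [eventually_ge_atTop 0] with t ht using ENNReal.ofReal_toReal (hfin t ht)
  · have hn : 0 < ‖w‖ := norm_pos_iff.2 h0
    have h1 : Tendsto (fun t => ENNReal.ofReal
        (p * (Φ (rescaled p Φ v t)).toReal / ‖rescaled p Φ v t‖ ^ p)) atTop
        (𝓝 (leastRayleigh p Φ)) := by
      rw [hmin w h0 hΦw hnw, rayleigh_eq_ofReal hp0.le h0 (hΦw ▸ ENNReal.ofReal_ne_top), hΦw,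
        ENNReal.toReal_ofReal hS]
      exact ENNReal.tendsto_ofReal ((hlim.const_mul p).div
        (hconv.norm.rpow_const (Or.inr hp0.le)) (by positivity))
    refine h1.congr' ?_
    filter_upwards [eventually_ge_atTop 0, hconv.eventually_ne h0] with t ht hne
    exact (rayleigh_rescaled hΦ hp0 (hv.apply_ne_top hv0 ht) hne).symm
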